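/- Let $G=(U,V,E)$ be a finite bipartite graph with edge weights $w_e\in\mathbb R$ ($e\in E$), capacities $c_u\in\mathbb Z_{\ge 0}$ ($u\in U$) and numbers $n_v\in\mathbb Z_{\ge 0}$ ($v\in V$). For each $v\in V$ let $\mathcal X_v\subseteq\mathbb R$ be the set of admissible prices and $p_v:\mathcal X_v\to[0,1]$ a function. Let $x=(x_v)_{v\in V}$ be any vector of prices with $x_v\in\mathcal X_v$ for all $v$. Let $D(x)=\prod_{v\in V}D_v(x)$ be the product distribution on $\mathbb Z_{\ge 0}^V$ in which each $D_v(x)$ is either the binomial distribution $\mathrm{Bin}(n_v,p_v(x_v))$ or the Poisson distribution $\mathrm{Po}(n_v\,p_v(x_v))$ (the choice may depend on $v$). For a node $a$ let $\delta(a)$ denote the set of edges incident to $a$. For $\xi\in\mathbb Z_{\ge 0}^V$ let $f(x,\xi)$ be the optimal value of the $b$-matching problem $$\max_{z\in\mathbb Z_{\ge 0}^E}\ \sum_{e=(u,v)\in E}(w_e+x_v)z_e\quad\text{s.t.}\quad \sum_{e\in\delta(v)}z_e\le \xi_v\ (v\in V),\qquad \sum_{e\in\delta(u)}z_e\le c_u\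 (u\in U),$$ and let $\hat f(x)$ be the optimal value of the fluid linear program $$\max_{z\in\mathbb R_{\ge 0}^E}\ \sum_{e=(u,v)\in E}(w_e+x_v)z_e\quad\text{s.t.}\quad \sum_{e\in\delta(v)}z_e\le n_v\,p_v(x_v)\ (v\in V),\qquad \sum_{e\in\delta(u)}z_e\le c_u\ (u\in U).$$ Then both maxima are attained, $f(x,\cdot)$ is integrable with respect to $D(x)$, and, with Euler's number $\mathrm e=2.718\ldots$, $$\Bigl(1-\frac1{\mathrm e}\Bigr)\hat f(x)\ \le\ \mathbb E_{\xi\sim D(x)}\bigl[f(x,\xi)\bigr]\ \le\ \hat f(x).$$ -/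

import Mathlib

open MeasureTheory ProbabilityTheory
open scoped NNReal unitInterval

/-- The family of distributions from which the random capacity of a participant group is drawn. -/
inductive DemandKind where
  | binomial
  | poisson

/-- The input data of the pricing and matching problem on a bipartite graph with resource types `U`
and participant groups `V`. -/
structure PricingMarket (U V : Type*) where
  /-- the edges `(u, v)` of the bipartite graph -/
  E : Finset (U × V)
  /-- the weights of the edges -/
  w : E → ℝ
  /-- the capacities of the resource types -/
  c : U → ℕ
  /-- the numbers `n_v` -/
  n : V → ℕ
  /-- the set of admissible prices of each participant group -/
  X : V → Set ℝ
  /-- the acceptance probability of each participant group, as a function of its price -/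
  p : (v : V) → X v → I
  /-- whether the capacity of the group is binomial or Poisson -/
  kind : V → DemandKind

namespace PricingMarket

variable {U V : Type*} (M : PricingMarket U V)

/-- The price vectors `x` with `x_v` in the domain of `p_v` for every `v`. -/
abbrev Price : Type _ := (v : V) → M.X v

/-- The mean capacity `n_v p_v(x_v)` of group `v`. -/
noncomputable def meanCapacity (x : M.Price) (v : V) : ℝ := M.n v * (M.p v (x v) : ℝ)

/-- The distribution of the capacity `ξ_v`: `Bin(n_v, p_v(x_v))` or `Po(n_v p_v(x_v))`. -/
noncomputable def capacityLaw (x : M.Price) (v : V) : Measure ℕ :=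
  match M.kind v with
  | .binomial => ProbabilityTheory.binomial (M.n v) (M.p v (x v))
  | .poisson => poissonMeasure ((M.n v : ℝ≥0) * unitInterval.toNNReal (M.p v (x v)))

instance (x : M.Price) (v : V) : IsProbabilityMeasure (M.capacityLaw x v) := by
  unfold capacityLaw
  cases M.kind v <;> infer_instance

/-- The joint distribution `D(x)` of the capacity vector `ξ`, the product of the `D_v(x)`. -/
noncomputable def jointLaw [Fintype V] (x : M.Price) : Measure (V → ℕ) :=
  Measure.pi (M.capacityLaw x)

/-- The reward `∑_{e = (u, v) ∈ E} (w_e + x_v) z_e`. -/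
noncomputable def reward (x : M.Price) (z : M.E → ℝ) : ℝ :=
  ∑ e : M.E, (M.w e + (x e.1.2 : ℝ)) * z e

variable [DecidableEq U] [DecidableEq V]

/-- `z` is a b-matching with capacities `ξ_v` on `V` and `c_u` on `U`. -/
def IsBMatching (ξ : V → ℕ) (z : M.E → ℕ) : Prop :=
  (∀ v : V, (∑ e : M.E with e.1.2 = v, z e) ≤ ξ v) ∧
    ∀ u : U, (∑ e : M.E with e.1.1 = u, z e) ≤ M.c u

/-- `z` is feasible for the fluid linear program at the prices `x`. -/
def IsFluidFeasible (x : M.Price) (z : M.E → ℝ) : Prop :=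
  (∀ e : M.E, 0 ≤ z e) ∧
    (∀ v : V, (∑ e : M.E with e.1.2 = v, z e) ≤ M.meanCapacity x v) ∧
      ∀ u : U, (∑ e : M.E with e.1.1 = u, z e) ≤ (M.c u : ℝ)

/-- The rewards of all b-matchings for the capacities `ξ`. -/
def matchingRewards (x : M.Price) (ξ : V → ℕ) : Set ℝ :=
  {r | ∃ z : M.E → ℕ, M.IsBMatching ξ z ∧ r = M.reward x (fun e => (z e : ℝ))}

/-- The rewards of all feasible points of the fluid linear program. -/
def fluidRewards (x : M.Price) : Set ℝ :=
  {r | ∃ z : M.E → ℝ, M.IsFluidFeasible x z ∧ r = M.reward x z}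

/-- `f(x, ξ)`, the optimal value of the b-matching problem. -/
noncomputable def f (x : M.Price) (ξ : V → ℕ) : ℝ := sSup (M.matchingRewards x ξ)

/-- The optimal value of the fluid linear program. -/
noncomputable def fHat (x : M.Price) : ℝ := sSup (M.fluidRewards x)

end PricingMarket

/-! Upper bound: averaging optimal b-matchings over `ξ` gives a feasible fluid point. Lower bound:
let `y` be an optimal fluid point and `μ_v` the mean capacities. Each of the `ξ_v` units of `v`
independently picks `u` with probability `y_uv / μ_v`, and each `u` keeps its best `c_u` units. By
`exists_layers_greedy` the positive reward kept at `u` is a nonnegative combination of terms `min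
(c_u, N_T)`, where `N_T` counts the units from `T` that picked `u`. Since `min (c, s) ≥ c (1 - (1 -
1/c)^s)` and generating functions multiply under independence, such a term has mean at least `c_u (1
- exp (-y_u(T) / c_u))`; the Poisson law is the worst case (`integral_pow_capacityLaw_le`). As
`y_u(T) ≤ c_u`, this is at least `(1 - 1/e) y_u(T)` (`one_sub_inv_exp_mul_le`), and the layers add
up to the fluid reward. The random choice of labels is replaced, for each `ξ`, by one at least as
good as the average. -/

/-! ### Means and generating functions of the capacities -/

namespace ProbabilityTheory

theorem integral_pow_binomial (n : ℕ) (p : I) (t : ℝ) :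
    ∫ k, t ^ k ∂(binomial n p) = (1 - (p : ℝ) * (1 - t)) ^ n := by
  rw [integral_binomial]
  have h : (1 - (p : ℝ) * (1 - t)) = p * t + (1 - p) := by ring
  rw [h, add_pow, ← Nat.range_succ_eq_Iic]
  refine Finset.sum_congr rfl fun k _ => ?_
  rw [smul_eq_mul, mul_pow]
  ring

theorem integral_cast_binomial (n : ℕ) (p : I) :
    ∫ k, (k : ℝ) ∂(binomial n p) = n * (p : ℝ) := by
  rw [integral_binomial, ← Nat.range_succ_eq_Iic]
  -- The Bernstein polynomials at `p` are the binomial probabilities.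
  have h := congrArg (Polynomial.eval (p : ℝ)) (bernsteinPolynomial.sum_smul ℝ n)
  rw [Polynomial.eval_finsetSum] at h
  simp only [Polynomial.eval_X, bernsteinPolynomial, Polynomial.eval_mul,
    Polynomial.eval_natCast, Polynomial.eval_pow, Polynomial.eval_sub, Polynomial.eval_one,
    nsmul_eq_mul] at h
  rw [← h]
  exact Finset.sum_congr rfl fun k _ => by rw [smul_eq_mul]; ring

theorem integral_pow_poissonMeasure (r : ℝ≥0) (t : ℝ) :
    ∫ k, t ^ k ∂(poissonMeasure r) = Real.exp (-(r * (1 - t))) := by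
  rw [integral_poissonMeasure]
  have h := (NormedSpace.expSeries_div_hasSum_exp ((r : ℝ) * t)).mul_left (Real.exp (-r))
  rw [← Real.exp_eq_exp_ℝ, ← Real.exp_add] at h
  rw [show -((r : ℝ) * (1 - t)) = -r + r * t by ring, ← h.tsum_eq]
  refine tsum_congr fun k => ?_
  rw [smul_eq_mul, mul_pow]
  ring

theorem hasSum_cast_poissonMeasure (r : ℝ≥0) :
    HasSum (fun k : ℕ => Real.exp (-r) * r ^ k / k.factorial * (k : ℝ)) r := by
  -- The term `k = 0` vanishes, and the shift turns `k r^k / k!` into `r` times the Poisson weights.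
  rw [← hasSum_nat_add_iff' 1]
  have h := (hasSum_one_poissonMeasure r).mul_left (r : ℝ)
  convert! h using 1
  · ext k
    rw [Nat.factorial_succ]
    push_cast
    field_simp
    ring
  · simp

theorem integrable_cast_poissonMeasure (r : ℝ≥0) :
    Integrable (fun k : ℕ => (k : ℝ)) (poissonMeasure r) := by
  rw [integrable_poissonMeasure_iff]
  simpa using (hasSum_cast_poissonMeasure r).summable

theorem integral_cast_poissonMeasure (r : ℝ≥0) :
    ∫ k, (k : ℝ) ∂(poissonMeasure r) = r := by
  rw [integral_poissonMeasure]
  exact (hasSum_cast_poissonMeasure r).tsum_eq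

end ProbabilityTheory

namespace PricingMarket

variable {U V : Type*} (M : PricingMarket U V)

theorem meanCapacity_nonneg (x : M.Price) (v : V) : 0 ≤ M.meanCapacity x v :=
  mul_nonneg (Nat.cast_nonneg _) (M.p v (x v)).2.1

theorem integrable_cast_capacityLaw (x : M.Price) (v : V) :
    Integrable (fun k : ℕ => (k : ℝ)) (M.capacityLaw x v) := by
  unfold capacityLaw
  cases M.kind v
  · exact integrable_binomial _
  · exact integrable_cast_poissonMeasure _

theorem integral_cast_capacityLaw (x : M.Price) (v : V) :
    ∫ k, (k : ℝ) ∂(M.capacityLaw x v) = M.meanCapacity x v := by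
  unfold capacityLaw meanCapacity
  cases M.kind v
  · exact integral_cast_binomial _ _
  · simp [integral_cast_poissonMeasure]

/-- The probability generating function of a capacity is at most that of the Poisson distribution
with the same mean. -/
theorem integral_pow_capacityLaw_le (x : M.Price) (v : V) {t : ℝ} (ht : 0 ≤ t) :
    ∫ k, t ^ k ∂(M.capacityLaw x v) ≤ Real.exp (-(M.meanCapacity x v * (1 - t))) := by
  unfold capacityLaw meanCapacity
  cases M.kind v
  · have hp := (M.p v (x v)).2
    simp only [integral_pow_binomial]
    rw [show -(M.n v * (M.p v (x v) : ℝ) * (1 - t)) = M.n v * (-((M.p v (x v) : ℝ) * (1 - t))) by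
      ring, Real.exp_nat_mul]
    refine pow_le_pow_left₀ ?_ (Real.one_sub_le_exp_neg _) _
    nlinarith [hp.1, hp.2, mul_nonneg hp.1 ht]
  · simp [integral_pow_poissonMeasure]

end PricingMarket

/-! ### Greedy filling, capped counts and random labels -/

/-- A nonnegative weight function `r` is a nonnegative combination of indicators of a chain of sets,
and filling a capacity `c` greedily by weight saturates all the sets of the chain at once. -/
theorem exists_layers_greedy {V : Type*} [DecidableEq V] (s : Finset V) (r : V → ℝ)
    (hr : ∀ v ∈ s, 0 ≤ r v) :
    ∃ (n : ℕ) (l : Fin n → ℝ) (T : Fin n → Finset V), (∀ i, 0 ≤ l i) ∧ (∀ i, T i ⊆ s) ∧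
      (∀ z : V → ℝ, ∑ v ∈ s, r v * z v = ∑ i, l i * ∑ v ∈ T i, z v) ∧
      ∀ (c : ℕ) (A : V → ℕ), ∃ B : V → ℕ, (∀ v, B v ≤ A v) ∧
        (∑ v ∈ s, B v = min c (∑ v ∈ s, A v)) ∧
        ∀ i, ∑ v ∈ T i, B v = min c (∑ v ∈ T i, A v) := by
  induction hk : s.card generalizing s r with
  | zero =>
    obtain rfl := Finset.card_eq_zero.1 hk
    exact ⟨0, Fin.elim0, Fin.elim0, fun i => i.elim0, fun i => i.elim0, by simp,
      fun c A => ⟨0, by simp, by simp, fun i => i.elim0⟩⟩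
  | succ k ih =>
    -- Peel off the layer `r a · 1_s` at a lightest `a`; the rest of the weight lives on `s.erase
    -- a`.
    obtain ⟨a, ha, hmin⟩ := s.exists_min_image r (Finset.card_pos.1 (by omega))
    obtain ⟨n, l, T, hl, hTs, hz, hB⟩ := ih (s.erase a) (fun v => r v - r a)
      (fun v hv => sub_nonneg.2 (hmin v (Finset.mem_of_mem_erase hv)))
      (by rw [Finset.card_erase_of_mem ha]; omega)
    have hT : ∀ i, a ∉ T i := fun i hi => Finset.notMem_erase a s (hTs i hi)
    refine ⟨n + 1, Fin.cons (r a) l, Fin.cons s T, ?_, ?_, ?_, ?_⟩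
    · intro i
      cases i using Fin.cases with
      | zero => exact hr a ha
      | succ i => exact hl i
    · intro i
      cases i using Fin.cases with
      | zero => exact subset_rfl
      | succ i => exact (hTs i).trans (Finset.erase_subset a s)
    · intro z
      simp only [Fin.sum_univ_succ, Fin.cons_zero, Fin.cons_succ, ← hz]
      rw [← Finset.add_sum_erase s _ ha, ← Finset.add_sum_erase s z ha]
      simp only [sub_mul, Finset.sum_sub_distrib, ← Finset.mul_sum]
      ring
    · intro c A
      obtain ⟨B, hBA, hBs, hBT⟩ := hB c A
      -- The lightest element gets only the leftover capacity; it lies in no smaller set of the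
      -- chain, so those stay saturated.
      have hs : ∑ v ∈ s, Function.update B a (min (A a) (c - ∑ v ∈ s.erase a, B v)) v =
          min c (∑ v ∈ s, A v) := by
        rw [← Finset.add_sum_erase s _ ha, ← Finset.add_sum_erase s A ha,
          Finset.sum_update_of_notMem (Finset.notMem_erase a s), Function.update_self]
        omega
      refine ⟨Function.update B a (min (A a) (c - ∑ v ∈ s.erase a, B v)), ?_, hs, ?_⟩
      · intro v
        by_cases hv : v = a
        · subst hv; simp
        · simpa [hv] using hBA v
      · intro i
        cases i using Fin.cases with
        | zero => exact hs
        | succ i =>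
          simpa only [Fin.cons_succ, Finset.sum_update_of_notMem (hT i)] using hBT i

/-- A concave lower bound for a capped count whose exponential form makes it multiplicative. -/
theorem mul_one_sub_pow_le_min (c s : ℕ) :
    (c : ℝ) * (1 - (1 - 1 / c) ^ s) ≤ (min c s : ℕ) := by
  rcases Nat.eq_zero_or_pos c with rfl | hc
  · simp
  have hc' : (1 : ℝ) ≤ c := by exact_mod_cast hc
  have h1 : 1 / (c : ℝ) ≤ 1 := by rw [div_le_one (by linarith)]; exact hc'
  rw [Nat.cast_min, le_min_iff]
  constructor
  · have : 0 ≤ (1 - 1 / (c : ℝ)) ^ s := pow_nonneg (by linarith) _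
    nlinarith
  -- Bernoulli: `(1 - 1/c)^s ≥ 1 - s/c`.
  · have h := one_add_mul_le_pow (a := -(1 / (c : ℝ))) (by linarith) s
    rw [← sub_eq_add_neg] at h
    have : (c : ℝ) * (1 - (1 - 1 / c) ^ s) ≤ c * (s * (1 / c)) := by
      apply mul_le_mul_of_nonneg_left _ (by linarith); linarith
    refine this.trans (le_of_eq ?_)
    field_simp

/-- By convexity `exp` lies below its chord on `[-1, 0]`, evaluated at `-m/c`. -/
theorem one_sub_inv_exp_mul_le {c m : ℝ} (hm : 0 ≤ m) (hmc : m ≤ c) :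
    (1 - 1 / Real.exp 1) * m ≤ c * (1 - Real.exp (-(m / c))) := by
  rcases hm.eq_or_lt with rfl | hm
  · simp
  have hc : 0 < c := hm.trans_le hmc
  have ht1 : m / c ≤ 1 := (div_le_one hc).2 hmc
  have h := convexOn_exp.2 (Set.mem_univ (0 : ℝ)) (Set.mem_univ (-1 : ℝ))
    (sub_nonneg.2 ht1) (div_pos hm hc).le (by ring)
  simp only [smul_eq_mul, mul_zero, mul_neg, mul_one, zero_add, Real.exp_zero] at h
  rw [Real.exp_neg 1, inv_eq_one_div] at h
  have h2 : (1 - 1 / Real.exp 1) * (m / c) ≤ 1 - Real.exp (-(m / c)) := by linarith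
  calc (1 - 1 / Real.exp 1) * m = c * ((1 - 1 / Real.exp 1) * (m / c)) := by field_simp
    _ ≤ _ := mul_le_mul_of_nonneg_left h2 hc.le

/-- Averages over independent choices of a label for each of finitely many items. -/
theorem exists_le_of_average {ι κ : Type*} [Fintype ι] [DecidableEq ι] [Fintype κ]
    (π : ι → κ → ℝ) (hπ : ∀ i k, 0 ≤ π i k) (hπ1 : ∀ i, ∑ k, π i k = 1) (F : (ι → κ) → ℝ) :
    ∃ g, ∑ τ, (∏ i, π i (τ i)) * F τ ≤ F g := by
  have hW : ∑ τ : ι → κ, ∏ i, π i (τ i) = 1 := by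
    rw [← Fintype.prod_sum]; simp [hπ1]
  by_contra! h
  have hlt : ∑ g : ι → κ, (∏ i, π i (g i)) * F g <
      ∑ g : ι → κ, (∏ i, π i (g i)) * ∑ τ, (∏ i, π i (τ i)) * F τ := by
    apply Finset.sum_lt_sum
    · exact fun g _ => mul_le_mul_of_nonneg_left (h g).le (Finset.prod_nonneg fun i _ => hπ _ _)
    · obtain ⟨g, -, hg⟩ := Finset.exists_ne_zero_of_sum_ne_zero (hW.trans_ne one_ne_zero)
      exact ⟨g, Finset.mem_univ _, mul_lt_mul_of_pos_left (h g)
        (lt_of_le_of_ne (Finset.prod_nonneg fun i _ => hπ _ _) hg.symm)⟩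
  rw [← Finset.sum_mul, hW, one_mul] at hlt
  exact lt_irrefl _ hlt

/-- The average of `t ^ N`, where `N` counts the items of the classes in `T` that get label `u`. -/
theorem sum_prod_mul_pow_card {V κ : Type*} [Fintype V] [DecidableEq V] [Fintype κ] [DecidableEq κ]
    (ξ : V → ℕ) (π : V → κ → ℝ) (hπ : ∀ v, ∑ k, π v k = 1) (T : Finset V) (u : κ) (t : ℝ) :
    ∑ g : (Σ v, Fin (ξ v)) → κ, (∏ i, π i.1 (g i)) *
        t ^ (∑ v ∈ T, (Finset.univ.filter fun j : Fin (ξ v) => g ⟨v, j⟩ = u).card) =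
      ∏ v ∈ T, (1 - π v u * (1 - t)) ^ ξ v := by
  have h1 : ∀ g : (Σ v, Fin (ξ v)) → κ,
      t ^ (∑ v ∈ T, (Finset.univ.filter fun j : Fin (ξ v) => g ⟨v, j⟩ = u).card) =
        ∏ i : Σ v, Fin (ξ v), if i.1 ∈ T ∧ g i = u then t else 1 := by
    intro g
    rw [Fintype.prod_sigma, ← Finset.prod_pow_eq_pow_sum, ← Finset.prod_subset T.subset_univ]
    · refine Finset.prod_congr rfl fun v hv => ?_
      simp [hv, Finset.prod_ite]
    · intro v _ hv
      simp [hv]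
  have h2 : ∀ v, ∑ k, π v k * (if v ∈ T ∧ k = u then t else 1) =
      if v ∈ T then 1 - π v u * (1 - t) else 1 := by
    intro v
    split_ifs with hv
    · have : ∀ k, π v k * (if v ∈ T ∧ k = u then t else 1) =
          π v k - if k = u then π v k * (1 - t) else 0 := by
        intro k
        by_cases hk : k = u
        · simp only [hv, hk, and_self, if_true]; ring
        · simp [hk]
      simp only [this, Finset.sum_sub_distrib, hπ, Finset.sum_ite_eq', Finset.mem_univ, if_true]
    · simp [hv, hπ]
  simp only [h1, ← Finset.prod_mul_distrib]
  rw [← Fintype.prod_sum fun (i : Σ v, Fin (ξ v)) k =>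
    π i.1 k * (if i.1 ∈ T ∧ k = u then t else 1)]
  simp only [h2]
  rw [Fintype.prod_sigma, ← Finset.prod_subset T.subset_univ]
  · exact Finset.prod_congr rfl fun v hv => by simp [hv]
  · intro v _ hv
    simp [hv]

/-- Independent random assignment of the `ξ v` items of each class `v`, where label `u` has
probability `q u v`, shows the existence of an assignment with large capped counts. -/
theorem exists_assignment_capped_counts {U V : Type*} [Fintype U] [Fintype V] [DecidableEq U]
    [DecidableEq V] (ξ : V → ℕ) (q : U → V → ℝ) (hq : ∀ u v, 0 ≤ q u v)
    (hq1 : ∀ v, ∑ u, q u v ≤ 1) (c : U → ℕ) (N : U → ℕ) (l : ∀ u, Fin (N u) → ℝ)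
    (hl : ∀ u i, 0 ≤ l u i) (T : ∀ u, Fin (N u) → Finset V) :
    ∃ A : U → V → ℕ, (∀ v, ∑ u, A u v ≤ ξ v) ∧
      ∑ u, ∑ i, l u i * (c u * (1 - ∏ v ∈ T u i, (1 - q u v / c u) ^ ξ v)) ≤
        ∑ u, ∑ i, l u i * (min (c u) (∑ v ∈ T u i, A u v) : ℕ) := by
  -- The label `none` takes the missing probability: such units stay unassigned.
  set π : V → Option U → ℝ := fun v k => k.elim (1 - ∑ u, q u v) fun u => q u v with hπdef
  have hπ : ∀ v k, 0 ≤ π v k := by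
    intro v k
    cases k with
    | none => exact sub_nonneg.2 (hq1 v)
    | some u => exact hq u v
  have hπ1 : ∀ v, ∑ k, π v k = 1 := fun v => by simp [hπdef, Fintype.sum_option]
  set A : ((Σ v, Fin (ξ v)) → Option U) → U → V → ℕ := fun g u v =>
    (Finset.univ.filter fun j : Fin (ξ v) => g ⟨v, j⟩ = some u).card with hAdef
  -- The average is taken of the exponential lower bound, which factorizes; the minimum returns only
  -- for the chosen `g`.
  obtain ⟨g, hg⟩ := exists_le_of_average (fun (i : Σ v, Fin (ξ v)) => π i.1) (fun i => hπ i.1)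
    (fun i => hπ1 i.1) fun g =>
      ∑ u, ∑ i, l u i * (c u * (1 - (1 - 1 / (c u : ℝ)) ^ (∑ v ∈ T u i, A g u v)))
  refine ⟨A g, fun v => ?_, ?_⟩
  · have h := Finset.card_eq_sum_card_fiberwise (s := (Finset.univ : Finset (Fin (ξ v))))
      (t := (Finset.univ : Finset (Option U))) (f := fun j => g ⟨v, j⟩) (fun _ _ => by simp)
    rw [Fintype.sum_option, Finset.card_univ, Fintype.card_fin] at h
    exact h ▸ Nat.le_add_left _ _
  · calc _ = ∑ u, ∑ i, l u i * (c u * (1 - ∑ g : (Σ v, Fin (ξ v)) → Option U,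
          (∏ i, π i.1 (g i)) * (1 - 1 / (c u : ℝ)) ^ (∑ v ∈ T u i, A g u v))) := by
          refine Finset.sum_congr rfl fun u _ => Finset.sum_congr rfl fun i _ => ?_
          rw [sum_prod_mul_pow_card ξ π hπ1 (T u i) (some u)]
          congr 3
          refine Finset.prod_congr rfl fun v _ => ?_
          simp only [hπdef, Option.elim_some]
          ring
      _ = _ := by
          simp only [Finset.mul_sum]
          rw [Finset.sum_comm]
          refine Finset.sum_congr rfl fun u _ => ?_
          rw [Finset.sum_comm]
          refine Finset.sum_congr rfl fun i _ => ?_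
          have hW : ∑ g : (Σ v, Fin (ξ v)) → Option U, ∏ i, π i.1 (g i) = 1 := by
            rw [← Fintype.prod_sum fun (i : Σ v, Fin (ξ v)) k => π i.1 k]; simp [hπ1]
          have hF : ∀ F : ((Σ v, Fin (ξ v)) → Option U) → ℝ,
              1 - ∑ g, (∏ i, π i.1 (g i)) * F g = ∑ g, (∏ i, π i.1 (g i)) * (1 - F g) := by
            intro F
            simp only [mul_sub, mul_one, Finset.sum_sub_distrib, hW]
          rw [hF, Finset.mul_sum, Finset.mul_sum]
          exact Finset.sum_congr rfl fun g _ => by ring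
      _ ≤ _ := hg
      _ ≤ _ := Finset.sum_le_sum fun u _ => Finset.sum_le_sum fun i _ =>
          mul_le_mul_of_nonneg_left (mul_one_sub_pow_le_min _ _) (hl u i)

/-! ### Expectations under the product law -/

namespace PricingMarket

variable {U V : Type*} (M : PricingMarket U V)

section JointLaw

variable [Fintype V]

instance (x : M.Price) : IsProbabilityMeasure (M.jointLaw x) := by
  unfold jointLaw; infer_instance

theorem integrable_of_abs_le (x : M.Price) {g : (V → ℕ) → ℝ} {C : ℝ} (hg : ∀ ξ, |g ξ| ≤ C) :
    Integrable g (M.jointLaw x) :=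
  Integrable.of_bound Measurable.of_discrete.aestronglyMeasurable C (.of_forall hg)

theorem integrable_cast_eval (x : M.Price) (v : V) :
    Integrable (fun ξ : V → ℕ => (ξ v : ℝ)) (M.jointLaw x) :=
  integrable_comp_eval (μ := M.capacityLaw x) (f := fun k : ℕ => (k : ℝ))
    (M.integrable_cast_capacityLaw x v)

theorem integral_cast_eval (x : M.Price) (v : V) :
    ∫ ξ, (ξ v : ℝ) ∂(M.jointLaw x) = M.meanCapacity x v := by
  rw [← integral_cast_capacityLaw]
  exact integral_comp_eval (μ := M.capacityLaw x) (f := fun k : ℕ => (k : ℝ))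
    (M.integrable_cast_capacityLaw x v).aestronglyMeasurable

theorem integrable_prod_pow (x : M.Price) (T : Finset V) {t : V → ℝ} (ht0 : ∀ v, 0 ≤ t v)
    (ht1 : ∀ v, t v ≤ 1) : Integrable (fun ξ : V → ℕ => ∏ v ∈ T, t v ^ ξ v) (M.jointLaw x) := by
  refine M.integrable_of_abs_le x (C := 1) fun ξ => ?_
  rw [abs_of_nonneg (Finset.prod_nonneg fun v _ => pow_nonneg (ht0 v) _)]
  exact Finset.prod_le_one (fun v _ => pow_nonneg (ht0 v) _) fun v _ => pow_le_one₀ (ht0 v) (ht1 v)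

theorem integral_prod_pow_le [DecidableEq V] (x : M.Price) (T : Finset V) {t : V → ℝ} (ht : ∀ v, 0 ≤ t v) :
    ∫ ξ, ∏ v ∈ T, t v ^ ξ v ∂(M.jointLaw x) ≤
      Real.exp (-∑ v ∈ T, M.meanCapacity x v * (1 - t v)) := by
  have h : ∀ ξ : V → ℕ, ∏ v ∈ T, t v ^ ξ v = ∏ v, (if v ∈ T then t v else 1) ^ ξ v := by
    intro ξ
    rw [← Finset.prod_subset T.subset_univ]
    · exact Finset.prod_congr rfl fun v hv => by simp [hv]
    · intro v _ hv
      simp [hv]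
  simp only [h, jointLaw]
  rw [integral_fintype_prod_eq_prod fun v (k : ℕ) => (if v ∈ T then t v else 1) ^ k]
  calc _ ≤ ∏ v, Real.exp (-(M.meanCapacity x v * (1 - if v ∈ T then t v else 1))) := by
        refine Finset.prod_le_prod (fun v _ => integral_nonneg fun k => ?_) fun v _ =>
          M.integral_pow_capacityLaw_le x v ?_
        · refine pow_nonneg ?_ _; split_ifs; exacts [ht v, zero_le_one]
        · split_ifs; exacts [ht v, zero_le_one]
    _ = _ := by
        rw [← Real.exp_sum, Finset.sum_neg_distrib, ← Finset.sum_subset T.subset_univ]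
        · congr 2
          exact Finset.sum_congr rfl fun v hv => by simp [hv]
        · intro v _ hv
          simp [hv]

end JointLaw

/-! ### Edge sums, attainment of the maxima and the upper bound -/

/-- Extension of a function on the edges by zero to all pairs. -/
def extendZero [DecidableEq U] [DecidableEq V] {R : Type*} [Zero R] (z : M.E → R) (u : U) (v : V) :
    R :=
  if h : (u, v) ∈ M.E then z ⟨(u, v), h⟩ else 0

variable [DecidableEq U] [DecidableEq V]

theorem extendZero_nonneg {z : M.E → ℝ} (hz : ∀ e, 0 ≤ z e) (u : U) (v : V) :
    0 ≤ M.extendZero z u v := by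
  unfold extendZero
  split_ifs
  exacts [hz _, le_rfl]

theorem sum_eq_sum_extendZero [Fintype U] [Fintype V] {R : Type*} [AddCommMonoid R] (z : M.E → R) :
    ∑ e, z e = ∑ u, ∑ v, M.extendZero z u v := by
  have h : ∀ e : M.E, z e = M.extendZero z e.1.1 e.1.2 := fun e => by simp [extendZero]
  simp only [h]
  rw [Finset.sum_coe_sort M.E fun e => M.extendZero z e.1 e.2, ← Fintype.sum_prod_type']
  refine Finset.sum_subset (Finset.subset_univ _) fun e _ he => ?_
  simp [extendZero, he]

theorem sum_snd_eq_sum_extendZero [Fintype U] [Fintype V] {R : Type*} [AddCommMonoid R]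
    (z : M.E → R) (v : V) :
    ∑ e : M.E with e.1.2 = v, z e = ∑ u, M.extendZero z u v := by
  rw [Finset.sum_filter, sum_eq_sum_extendZero]
  refine Finset.sum_congr rfl fun u _ => ?_
  rw [Finset.sum_eq_single v]
  · simp [extendZero]
  · intro v' _ hv
    simp [extendZero, hv]
  · simp

theorem sum_fst_eq_sum_extendZero [Fintype U] [Fintype V] {R : Type*} [AddCommMonoid R]
    (z : M.E → R) (u : U) :
    ∑ e : M.E with e.1.1 = u, z e = ∑ v, M.extendZero z u v := by
  rw [Finset.sum_filter, sum_eq_sum_extendZero, Finset.sum_eq_single u]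
  · simp [extendZero]
  · intro u' _ hu
    simp [extendZero, hu]
  · simp

variable {M}

/-- A bound independent of `ξ`: it makes the feasible set finite and `f` bounded, hence integrable
even for Poisson capacities. -/
theorem IsBMatching.le {ξ : V → ℕ} {z : M.E → ℕ} (hz : M.IsBMatching ξ z) (e : M.E) :
    z e ≤ M.c e.1.1 :=
  (Finset.single_le_sum (f := z) (fun _ _ => Nat.zero_le _) (by simp)).trans (hz.2 e.1.1)

theorem IsFluidFeasible.le {x : M.Price} {z : M.E → ℝ} (hz : M.IsFluidFeasible x z) (e : M.E) :
    z e ≤ M.c e.1.1 :=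
  (Finset.single_le_sum (f := z) (fun _ _ => hz.1 _) (by simp)).trans (hz.2.2 e.1.1)

variable (M)

theorem isGreatest_f (x : M.Price) (ξ : V → ℕ) :
    IsGreatest (M.matchingRewards x ξ) (M.f x ξ) := by
  have hfin : (M.matchingRewards x ξ).Finite := by
    have h : {z : M.E → ℕ | M.IsBMatching ξ z}.Finite :=
      (Set.finite_Iic fun e : M.E => M.c e.1.1).subset fun z hz e => hz.le e
    refine (h.image fun z => M.reward x fun e => (z e : ℝ)).subset ?_
    rintro _ ⟨z, hz, rfl⟩
    exact ⟨z, hz, rfl⟩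
  have hne : (M.matchingRewards x ξ).Nonempty := ⟨_, 0, by simp [IsBMatching], rfl⟩
  exact ⟨hne.csSup_mem hfin, fun r hr => le_csSup hfin.bddAbove hr⟩

theorem isGreatest_fHat (x : M.Price) : IsGreatest (M.fluidRewards x) (M.fHat x) := by
  have hc : IsCompact {z : M.E → ℝ | M.IsFluidFeasible x z} := by
    refine (isCompact_Icc (a := (0 : M.E → ℝ)) (b := fun e => (M.c e.1.1 : ℝ))).of_isClosed_subset
      ?_ fun z hz => ⟨hz.1, fun e => hz.le e⟩
    simp only [IsFluidFeasible, Set.ofPred_and, Set.ofPred_forall]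
    refine (isClosed_iInter fun e => ?_).inter
      ((isClosed_iInter fun v => ?_).inter (isClosed_iInter fun u => ?_))
    all_goals exact isClosed_le (by fun_prop) (by fun_prop)
  have himg : M.fluidRewards x = M.reward x '' {z : M.E → ℝ | M.IsFluidFeasible x z} := by
    ext r
    simp only [fluidRewards, Set.mem_ofPred_eq, Set.mem_image, eq_comm]
  have hcont : Continuous (M.reward x) := by unfold reward; fun_prop
  have h := (hc.image hcont).isGreatest_sSup
    ⟨_, 0, ⟨fun e => le_rfl, fun v => by simpa using M.meanCapacity_nonneg x v, fun u => by simp⟩,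
      rfl⟩
  rwa [← himg] at h

theorem abs_reward_le (x : M.Price) (ξ : V → ℕ) {z : M.E → ℕ} (hz : M.IsBMatching ξ z) :
    |M.reward x fun e => (z e : ℝ)| ≤ ∑ e : M.E, |M.w e + (x e.1.2 : ℝ)| * M.c e.1.1 := by
  refine (Finset.abs_sum_le_sum_abs _ _).trans (Finset.sum_le_sum fun e _ => ?_)
  rw [abs_mul, Nat.abs_cast]
  exact mul_le_mul_of_nonneg_left (by exact_mod_cast hz.le e) (abs_nonneg _)

section Expectation

variable [Fintype V]

theorem integrable_f (x : M.Price) : Integrable (M.f x) (M.jointLaw x) := by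
  refine M.integrable_of_abs_le x (C := ∑ e : M.E, |M.w e + (x e.1.2 : ℝ)| * M.c e.1.1) fun ξ => ?_
  obtain ⟨z, hz, hr⟩ := (M.isGreatest_f x ξ).1
  rw [hr]
  exact M.abs_reward_le x ξ hz

/-- The expectation of an optimal b-matching is feasible for the fluid linear program. -/
theorem integral_f_le_fHat (x : M.Price) : ∫ ξ, M.f x ξ ∂(M.jointLaw x) ≤ M.fHat x := by
  choose z hz hr using fun ξ => (M.isGreatest_f x ξ).1
  have hint : ∀ e, Integrable (fun ξ => (z ξ e : ℝ)) (M.jointLaw x) := fun e =>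
    M.integrable_of_abs_le x (C := M.c e.1.1) fun ξ => by
      rw [Nat.abs_cast]; exact_mod_cast (hz ξ).le e
  refine (M.isGreatest_fHat x).2 ⟨fun e => ∫ ξ, (z ξ e : ℝ) ∂(M.jointLaw x), ⟨?_, ?_, ?_⟩, ?_⟩
  · exact fun e => integral_nonneg fun ξ => Nat.cast_nonneg _
  · intro v
    rw [← integral_finsetSum _ fun e _ => hint e, ← M.integral_cast_eval]
    refine integral_mono (integrable_finsetSum _ fun e _ => hint e) (M.integrable_cast_eval x v)
      fun ξ => ?_
    simpa using (Nat.cast_le (α := ℝ)).2 ((hz ξ).1 v)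
  · intro u
    rw [← integral_finsetSum _ fun e _ => hint e]
    refine (integral_mono (integrable_finsetSum _ fun e _ => hint e)
      (integrable_const (M.c u : ℝ)) fun ξ => ?_).trans_eq (by simp)
    simpa using (Nat.cast_le (α := ℝ)).2 ((hz ξ).2 u)
  · simp only [hr, reward]
    rw [integral_finsetSum _ fun e _ => (hint e).const_mul _]
    simp only [integral_const_mul]

end Expectation

/-- The positive part of the reward of a pair, zero off the edges. -/
noncomputable def posReward (x : M.Price) (u : U) (v : V) : ℝ :=
  M.extendZero (fun e => max (M.w e + (x e.1.2 : ℝ)) 0) u v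

theorem posReward_nonneg (x : M.Price) (u : U) (v : V) : 0 ≤ M.posReward x u v :=
  M.extendZero_nonneg (fun _ => le_max_right _ _) u v

variable [Fintype U] [Fintype V]

/-- Dropping the units on non-edges and on edges of negative reward keeps feasibility and loses no
positive reward. -/
theorem sum_posReward_mul_le_f (x : M.Price) (ξ : V → ℕ) (B : U → V → ℕ)
    (hV : ∀ v, ∑ u, B u v ≤ ξ v) (hU : ∀ u, ∑ v, B u v ≤ M.c u) :
    ∑ u, ∑ v, M.posReward x u v * B u v ≤ M.f x ξ := by
  set z : M.E → ℕ := fun e => if 0 ≤ M.w e + (x e.1.2 : ℝ) then B e.1.1 e.1.2 else 0 with hz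
  have hle : ∀ u v, M.extendZero z u v ≤ B u v := by
    intro u v
    simp only [extendZero, hz]
    split_ifs
    exacts [le_rfl, Nat.zero_le _, Nat.zero_le _]
  refine (M.isGreatest_f x ξ).2 ⟨z, ⟨fun v => ?_, fun u => ?_⟩, ?_⟩
  · rw [sum_snd_eq_sum_extendZero]
    exact (Finset.sum_le_sum fun u _ => hle u v).trans (hV v)
  · rw [sum_fst_eq_sum_extendZero]
    exact (Finset.sum_le_sum fun v _ => hle u v).trans (hU u)
  · rw [reward, sum_eq_sum_extendZero]
    refine Finset.sum_congr rfl fun u _ => Finset.sum_congr rfl fun v _ => ?_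
    simp only [posReward, extendZero, hz]
    split_ifs with h1 h2
    · rw [max_eq_left h2]
    · rw [max_eq_right (not_le.1 h2).le]; simp
    · simp

theorem reward_le_sum_posReward_mul (x : M.Price) {z : M.E → ℝ} (hz : ∀ e, 0 ≤ z e) :
    M.reward x z ≤ ∑ u, ∑ v, M.posReward x u v * M.extendZero z u v := by
  rw [reward, sum_eq_sum_extendZero]
  refine Finset.sum_le_sum fun u _ => Finset.sum_le_sum fun v _ => ?_
  simp only [posReward, extendZero]
  split_ifs
  · exact mul_le_mul_of_nonneg_right (le_max_left _ _) (hz _)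
  · simp

/-! ### The lower bound -/

theorem fHat_le_integral_f (x : M.Price) :
    (1 - 1 / Real.exp 1) * M.fHat x ≤ ∫ ξ, M.f x ξ ∂(M.jointLaw x) := by
  obtain ⟨z, hz, hr⟩ := (M.isGreatest_fHat x).1
  set y : U → V → ℝ := M.extendZero z with hy
  have hy0 : ∀ u v, 0 ≤ y u v := M.extendZero_nonneg hz.1
  have hyV : ∀ v, ∑ u, y u v ≤ M.meanCapacity x v := fun v =>
    (M.sum_snd_eq_sum_extendZero z v).symm.trans_le (hz.2.1 v)
  have hyU : ∀ u, ∑ v, y u v ≤ M.c u := fun u =>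
    (M.sum_fst_eq_sum_extendZero z u).symm.trans_le (hz.2.2 u)
  have hyle : ∀ u v, y u v ≤ M.meanCapacity x v := fun u v =>
    (Finset.single_le_sum (f := fun u => y u v) (fun u _ => hy0 u v) (Finset.mem_univ u)).trans
      (hyV v)
  set q : U → V → ℝ := fun u v => y u v / M.meanCapacity x v with hq
  have hq0 : ∀ u v, 0 ≤ q u v := fun u v => div_nonneg (hy0 u v) (M.meanCapacity_nonneg x v)
  have hq1 : ∀ v, ∑ u, q u v ≤ 1 := fun v => by
    rw [hq, ← Finset.sum_div]
    exact div_le_one_of_le₀ (hyV v) (M.meanCapacity_nonneg x v)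
  -- If the mean is `0`, then `y` vanishes too, so the value `q = 0` from division by zero is
  -- harmless.
  have hμq : ∀ u v, M.meanCapacity x v * q u v = y u v := fun u v => by
    rcases (M.meanCapacity_nonneg x v).eq_or_lt with h | h
    · have := le_antisymm ((hyle u v).trans_eq h.symm) (hy0 u v)
      rw [← h, this, zero_mul]
    · exact mul_div_cancel₀ _ h.ne'
  have hqle : ∀ u v, q u v ≤ 1 := fun u v =>
    div_le_one_of_le₀ (hyle u v) (M.meanCapacity_nonneg x v)
  set t : U → V → ℝ := fun u v => 1 - q u v / M.c u with ht
  have ht1 : ∀ u v, t u v ≤ 1 := fun u v => sub_le_self _ (div_nonneg (hq0 u v) (Nat.cast_nonneg _))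
  have ht0 : ∀ u v, 0 ≤ t u v := fun u v => by
    rcases Nat.eq_zero_or_pos (M.c u) with h | h
    · simp [ht, h]
    · have : (1 : ℝ) ≤ M.c u := by exact_mod_cast h
      exact sub_nonneg.2 (div_le_one_of_le₀ ((hqle u v).trans this) (Nat.cast_nonneg _))
  -- The layers depend only on the rewards, not on `ξ`, so expectations can be taken layer by layer.
  choose N l T hl _ hlin hgreedy using fun u =>
    exists_layers_greedy Finset.univ (M.posReward x u) fun v _ => M.posReward_nonneg x u v
  have hpoint : ∀ ξ : V → ℕ,
      ∑ u, ∑ i, l u i * (M.c u * (1 - ∏ v ∈ T u i, t u v ^ ξ v)) ≤ M.f x ξ := by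
    intro ξ
    obtain ⟨A, hA, hle⟩ := exists_assignment_capped_counts ξ q hq0 hq1 M.c N l hl T
    refine hle.trans ?_
    choose B hBA hBU hBT using fun u => hgreedy u (M.c u) (A u)
    refine le_trans (le_of_eq ?_) (M.sum_posReward_mul_le_f x ξ B
      (fun v => (Finset.sum_le_sum fun u _ => hBA u v).trans (hA v))
      fun u => (hBU u).trans_le (min_le_left _ _))
    refine Finset.sum_congr rfl fun u _ => ?_
    rw [hlin u fun v => (B u v : ℝ)]
    refine Finset.sum_congr rfl fun i _ => ?_
    rw [← hBT, Nat.cast_sum]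
  have hint : ∀ u i, Integrable (fun ξ : V → ℕ => l u i * (M.c u * (1 - ∏ v ∈ T u i, t u v ^ ξ v)))
      (M.jointLaw x) := fun u i =>
    (((integrable_const _).sub (M.integrable_prod_pow x (T u i) (ht0 u) (ht1 u))).const_mul
      _).const_mul _
  have he : 0 ≤ 1 - 1 / Real.exp 1 :=
    sub_nonneg.2 (div_le_one_of_le₀ (Real.one_le_exp zero_le_one) (Real.exp_pos _).le)
  calc (1 - 1 / Real.exp 1) * M.fHat x
      ≤ (1 - 1 / Real.exp 1) * ∑ u, ∑ v, M.posReward x u v * y u v :=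
        mul_le_mul_of_nonneg_left (hr.trans_le (M.reward_le_sum_posReward_mul x hz.1)) he
    _ = ∑ u, ∑ i, l u i * ((1 - 1 / Real.exp 1) * ∑ v ∈ T u i, y u v) := by
        simp only [hlin, Finset.mul_sum]
        refine Finset.sum_congr rfl fun u _ => Finset.sum_congr rfl fun i _ =>
          Finset.sum_congr rfl fun v _ => by ring
    _ ≤ ∑ u, ∑ i, l u i * (M.c u * (1 - ∫ ξ, ∏ v ∈ T u i, t u v ^ ξ v ∂(M.jointLaw x))) := by
        refine Finset.sum_le_sum fun u _ => Finset.sum_le_sum fun i _ =>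
          mul_le_mul_of_nonneg_left ?_ (hl u i)
        refine (one_sub_inv_exp_mul_le (Finset.sum_nonneg fun v _ => hy0 u v)
          ((Finset.sum_le_univ_sum_of_nonneg (hy0 u)).trans (hyU u))).trans
          (mul_le_mul_of_nonneg_left (sub_le_sub_left ?_ _) (Nat.cast_nonneg _))
        refine (M.integral_prod_pow_le x (T u i) (ht0 u)).trans_eq ?_
        rw [Finset.sum_div]
        congr 2
        refine Finset.sum_congr rfl fun v _ => ?_
        -- The exponent matches because `μ_v (1 - t u v) = y u v / c_u`.
        rw [← hμq u v]
        simp only [ht]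
        ring
    _ = ∫ ξ, ∑ u, ∑ i, l u i * (M.c u * (1 - ∏ v ∈ T u i, t u v ^ ξ v)) ∂(M.jointLaw x) := by
        rw [integral_finsetSum _ fun u _ => integrable_finsetSum _ fun i _ => hint u i]
        refine Finset.sum_congr rfl fun u _ => ?_
        rw [integral_finsetSum _ fun i _ => hint u i]
        refine Finset.sum_congr rfl fun i _ => ?_
        rw [integral_const_mul, integral_const_mul, integral_sub (integrable_const _)
          (M.integrable_prod_pow x (T u i) (ht0 u) (ht1 u))]
        simp
    _ ≤ _ := integral_mono
        (integrable_finsetSum _ fun u _ => integrable_finsetSum _ fun i _ => hint u i)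
        (M.integrable_f x) hpoint

end PricingMarket

theorem theorem1 {U V : Type*} [Fintype U] [Fintype V] [DecidableEq U] [DecidableEq V]
    (M : PricingMarket U V) (x : M.Price) :
    (∀ ξ : V → ℕ, IsGreatest (M.matchingRewards x ξ) (M.f x ξ)) ∧
    IsGreatest (M.fluidRewards x) (M.fHat x) ∧
    Integrable (M.f x) (M.jointLaw x) ∧
    (1 - 1 / Real.exp 1) * M.fHat x ≤ ∫ ξ, M.f x ξ ∂(M.jointLaw x) ∧
    ∫ ξ, M.f x ξ ∂(M.jointLaw x) ≤ M.fHat x :=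
  ⟨M.isGreatest_f x, M.isGreatest_fHat x, M.integrable_f x, M.fHat_le_integral_f x,
    M.integral_f_le_fHat x⟩
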